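/- Let $k$ be an algebraically closed field of characteristic zero. A (non-symmetric) binary quadratic operad $\mathcal P=\mathcal P(\Omega,\Lambda)$ is given by a finite-dimensional $k$-vector space $\Omega$ of binary operations and a subspace $\Lambda\subset\Omega^{\otimes 2}\oplus\Omega^{\otimes 2}$ of relations, where a pair $\left(\sum f_{ab}\,a\otimes b,\ \sum g_{ab}\,a\otimes b\right)$ stands for the relation $\sum f_{ab}\,(x\mathbin{a}y)\mathbin{b}z=\sum g_{ab}\,x\mathbin{a}(y\mathbin{b}z)$; $\mathcal P$ is the quotient of the free non-symmetric operad on $\Omega$ by the operadic ideal generated by these relations, and $\mathcal P(n)$ is its component of arity $n$. The black square product is $\mathcal P\,\blacksquare\,\mathcal Q=\mathcal P(\Omega_{\mathcal P}\otimes\Omega_{\mathcal Q},\Lambda)$, where $\Lambda$ is spanned by the pairs $(S_{23}(f\otimes f'),S_{23}(g\otimes g'))$ with $(f,g)\in\Lambda_{\mathcal P}$, $(f',g')\in\Lambda_{\mathcal Q}$, and $S_{23}$ switches the two middle tensor factors. The quadratic dual is $\mathcal P^!=\mathcal P(\Omega^{\vee},\Lambda^{\perp})$, with $\Omega^\vee$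 the linear dual of $\Omega$ and $\perp$ taken with respect to the pairing $\langle (f,g),(f',g')\rangle=\langle f,f'\rangle-\langle g,g'\rangle$. Let $\mathcal Dend$ be the operad with two operations $\prec,\succ$ and, with $*=\prec+\succ$, the three relations $$(x\prec y)\prec z=x\prec(y* z),\qquad (x\succ y)\prec z=x\succ(y\prec z),\qquad (x* y)\succ z=x\succ(y\succ z).$$ Then for every $m\ge 1$ and every $n$, the quadratic dual of the $m$-fold black square product $\mathcal Dend^{\blacksquare m}=\mathcal Dend\,\blacksquare\cdots\blacksquare\,\mathcal Dend$ satisfies $$\dim\,(\mathcal Dend^{\blacksquare m})^!(n)\le n^m .$$ -/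

import Mathlib

/-!
Non-symmetric binary quadratic operads over a field `k`, presented by generators and relations.
A labelled planar binary tree is a `BinaryTree X`: inner vertices carry operations from `X`, and
`BinaryTree.nil` is a leaf (the identity operation, when it is the whole tree).
-/

/-- A presentation `𝒫(Ω, Λ)` of a binary quadratic non-symmetric operad with a finite number of
generating binary operations. `Ω` is the vector space with basis `Gen`, so `Ω ⊗ Ω` is
`Gen × Gen → k`, and `Λ = Rel` is a subspace of `(Ω ⊗ Ω) ⊕ (Ω ⊗ Ω)`. An element `(f, g)` of `Rel`
stands for the relation
`∑ f (a, b) • ((x a y) b z) = ∑ g (a, b) • (x a (y b z))`. -/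
structure QuadraticData (k : Type*) [Field k] where
  Gen : Type
  [fintypeGen : Fintype Gen]
  Rel : Submodule k ((Gen × Gen → k) × (Gen × Gen → k))

attribute [instance] QuadraticData.fintypeGen

noncomputable section

namespace FreeOperad

/-- `graft t i s` is the tree `t ∘ᵢ s` obtained by gluing the root of `s` to the leaf number `i`
of `t`. Leaves are numbered from left to right, starting with `0`; the value is meaningful only
for `i < t.numLeaves`. -/
def graft {X : Type} : BinaryTree X → ℕ → BinaryTree X → BinaryTree X
  | .nil, _, s => s
  | .node x l r, i, s =>
      if i < l.numLeaves then .node x (graft l i s) r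
      else .node x l (graft r (i - l.numLeaves) s)

/-- The arity `n` component of the free non-symmetric operad on the binary operations `X`: the
space spanned by the labelled planar binary trees with `n` leaves. -/
def component (k : Type*) [Field k] (X : Type) (n : ℕ) : Submodule k (BinaryTree X →₀ k) :=
  Finsupp.supported k k {t | t.numLeaves = n}

/-- The partial composition `u ∘ᵢ v`, the bilinear extension of grafting. -/
def comp {k : Type*} [Field k] {X : Type} (u : BinaryTree X →₀ k) (i : ℕ)
    (v : BinaryTree X →₀ k) : BinaryTree X →₀ k :=
  u.sum fun t a => v.sum fun s b => Finsupp.single (graft t i s) (a * b)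

/-- Operadic ideals of the free operad: families of subspaces of the components that are closed
under partial composition, on either side, with arbitrary elements of the free operad. -/
structure IsIdeal {k : Type*} [Field k] {X : Type}
    (I : ℕ → Submodule k (BinaryTree X →₀ k)) : Prop where
  le_component : ∀ n, I n ≤ component k X n
  comp_mem_left : ∀ p q i, i < p → ∀ u ∈ I p, ∀ v ∈ component k X q,
    comp u i v ∈ I (p + q - 1)
  comp_mem_right : ∀ p q i, i < p → ∀ u ∈ component k X p, ∀ v ∈ I q,
    comp u i v ∈ I (p + q - 1)

end FreeOperad

namespace QuadraticData

variable {k : Type*} [Field k]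

/-- The element of the free operad, of arity three, that a pair `(f, g)` sets to zero:
left-hand side minus right-hand side of the relation. -/
def relator {X : Type} [Fintype X] (w : (X × X → k) × (X × X → k)) : BinaryTree X →₀ k :=
  (∑ p : X × X, Finsupp.single (.node p.2 (.node p.1 .nil .nil) .nil) (w.1 p)) -
    ∑ p : X × X, Finsupp.single (.node p.1 .nil (.node p.2 .nil .nil)) (w.2 p)

/-- The operadic ideal generated by the relations, in arity `n`: the intersection of all operadic
ideals that contain the relations. -/
def ideal (P : QuadraticData k) (n : ℕ) : Submodule k (BinaryTree P.Gen →₀ k) :=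
  sInf {J | ∃ I : ℕ → Submodule k (BinaryTree P.Gen →₀ k),
    FreeOperad.IsIdeal I ∧ (∀ w ∈ P.Rel, relator w ∈ I 3) ∧ J = I n}

/-- The component `𝒫(n)` of the operad `𝒫(Ω, Λ)`: the arity `n` component of the free operad modulo
the arity `n` part of the ideal generated by the relations, realized as the image of the component
in the quotient of the space of all tree polynomials. -/
abbrev component (P : QuadraticData k) (n : ℕ) :
    Submodule k ((BinaryTree P.Gen →₀ k) ⧸ P.ideal n) :=
  (FreeOperad.component k P.Gen n).map (P.ideal n).mkQ

/-- The tensor product of `f ∈ Ω_P ⊗ Ω_P` and `g ∈ Ω_Q ⊗ Ω_Q` with the two middle factors switched,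
as an element of `(Ω_P ⊗ Ω_Q) ⊗ (Ω_P ⊗ Ω_Q)`. -/
def switch {X Y : Type} (f : X × X → k) (g : Y × Y → k) : (X × Y) × (X × Y) → k :=
  fun p => f (p.1.1, p.2.1) * g (p.1.2, p.2.2)

/-- The black square product: the operations are pairs of operations, the relations are spanned by
the pairs of relations. -/
def blackSquare (P Q : QuadraticData k) : QuadraticData k where
  Gen := P.Gen × Q.Gen
  Rel := Submodule.span k
    {w | ∃ u ∈ P.Rel, ∃ v ∈ Q.Rel, w = (switch u.1 v.1, switch u.2 v.2)}

/-- The operad of associative algebras, which is neutral for the black square product. -/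
def assoc (k : Type*) [Field k] : QuadraticData k where
  Gen := Unit
  Rel := Submodule.span k {(1, 1)}

/-- The `m`-fold black square product `P ■ ⋯ ■ P`. -/
def blackSquarePow (P : QuadraticData k) : ℕ → QuadraticData k
  | 0 => assoc k
  | 1 => P
  | m + 2 => blackSquare (blackSquarePow P (m + 1)) P

/-- The pairing between `(Ω ⊗ Ω) ⊕ (Ω ⊗ Ω)` and the same space for the dual `Ω^∨`, in terms of a
basis and its dual basis; the second summand carries a sign. -/
def pairing {X : Type} [Fintype X] (u v : (X × X → k) × (X × X → k)) : k :=
  ∑ p, u.1 p * v.1 p - ∑ p, u.2 p * v.2 p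

/-- The quadratic dual `𝒫(Ω^∨, Λ^⊥)`; the generators are the dual basis, indexed by the same
set. -/
def dual (P : QuadraticData k) : QuadraticData k where
  Gen := P.Gen
  Rel :=
    { carrier := {v | ∀ u ∈ P.Rel, pairing u v = 0}
      zero_mem' := by
        intro u _
        simp [pairing]
      add_mem' := by
        intro v w hv hw u hu
        have h1 := hv u hu
        have h2 := hw u hu
        simp only [pairing, Prod.fst_add, Prod.snd_add, Pi.add_apply, mul_add,
          Finset.sum_add_distrib] at h1 h2 ⊢
        linear_combination h1 + h2
      smul_mem' := by
        intro c v hv u hu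
        have h1 := hv u hu
        simp only [pairing, Prod.smul_fst, Prod.smul_snd, Pi.smul_apply, smul_eq_mul,
          mul_left_comm _ c, ← Finset.mul_sum] at h1 ⊢
        linear_combination c * h1 }

end QuadraticData

/-- The two dendriform operations `≺` and `≻`. -/
inductive DendOp : Type
  | prec
  | succ
  deriving DecidableEq

instance : Fintype DendOp where
  elems := {DendOp.prec, DendOp.succ}
  complete := by
    intro x
    cases x <;> simp

open DendOp in
/-- The dendriform operad: with `* = ≺ + ≻`, the relations are
`(x ≺ y) ≺ z = x ≺ (y * z)`, `(x ≻ y) ≺ z = x ≻ (y ≺ z)` and `(x * y) ≻ z = x ≻ (y ≻ z)`. -/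
def Dend (k : Type*) [Field k] : QuadraticData k where
  Gen := DendOp
  Rel := Submodule.span k
    {(Pi.single (prec, prec) 1, Pi.single (prec, prec) 1 + Pi.single (prec, succ) 1),
     (Pi.single (succ, prec) 1, Pi.single (succ, prec) 1),
     (Pi.single (prec, succ) 1 + Pi.single (succ, succ) 1, Pi.single (succ, succ) 1)}

end

/-! In the dual, a relation becomes an equality between single monomials. Each generating relation
of `Dend` is a pair of indicator functions of one class in `Fin 3`, for `leftClass` and for
`rightClass`; so coefficients of relations of the `m`-fold product depend only on coordinatewise
classes. Hence `(x a y) b z = x c (y d z)` holds in the dual whenever the classes agree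
(`single_mem_dual_rel`). Both shapes realize every class, so every tree can be rotated to a right
comb. Since `≺` on the left of a right-nested pair hides the next label, each coordinate of the comb
normalizes to a run of `≻` followed by `≺` only (`exists_congr_comb`). In arity `n + 1` such a run
has `n + 1` possible lengths, so `(n + 1) ^ m` combs span. -/

namespace DendOp

/-- The position, among the three inputs, that the diassociative monomial `(x a y) b z` marks. -/
def leftClass : DendOp → DendOp → Fin 3
  | prec, prec => 0
  | succ, prec => 1
  | _, succ => 2

/-- The position, among the three inputs, that the diassociative monomial `x a (y b z)` marks. -/
def rightClass : DendOp → DendOp → Fin 3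
  | prec, _ => 0
  | succ, prec => 1
  | succ, succ => 2

theorem exists_rightClass_eq (c : Fin 3) : ∃ p : DendOp × DendOp, rightClass p.1 p.2 = c := by
  fin_cases c
  · exact ⟨(prec, prec), rfl⟩
  · exact ⟨(succ, prec), rfl⟩
  · exact ⟨(succ, succ), rfl⟩

theorem exists_leftClass_eq (c : Fin 3) : ∃ p : DendOp × DendOp, leftClass p.1 p.2 = c := by
  fin_cases c
  · exact ⟨(prec, prec), rfl⟩
  · exact ⟨(succ, prec), rfl⟩
  · exact ⟨(succ, succ), rfl⟩

end DendOp

/-! ### Relations of the black square powers and of their duals. -/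

namespace QuadraticData

open DendOp FreeOperad

variable {k : Type*} [Field k]

/-- The generators of `P` are identified with `m`-tuples of dendriform operations in such a way
that the coefficients of every relation depend only on the classes of the coordinates. -/
def IsDendLike (P : QuadraticData k) {m : ℕ} (e : P.Gen ≃ (Fin m → DendOp)) : Prop :=
  ∀ u ∈ P.Rel, ∃ φ : (Fin m → Fin 3) → k,
    (∀ a b, u.1 (a, b) = φ fun i => leftClass (e a i) (e b i)) ∧
    ∀ a b, u.2 (a, b) = φ fun i => rightClass (e a i) (e b i)

theorem exists_coeff_of_mem_dend_rel {u : (DendOp × DendOp → k) × (DendOp × DendOp → k)}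
    (hu : u ∈ (Dend k).Rel) : ∃ φ : Fin 3 → k,
      (∀ a b, u.1 (a, b) = φ (leftClass a b)) ∧ ∀ a b, u.2 (a, b) = φ (rightClass a b) := by
  change u ∈ Submodule.span k _ at hu
  induction hu using Submodule.span_induction with
  | mem x hx =>
    rcases hx with rfl | rfl | rfl
    · refine ⟨Pi.single 0 1, ?_, ?_⟩ <;> rintro (_ | _) (_ | _) <;>
        simp [leftClass, rightClass]
    · refine ⟨Pi.single 1 1, ?_, ?_⟩ <;> rintro (_ | _) (_ | _) <;>
        simp [leftClass, rightClass]
    · refine ⟨Pi.single 2 1, ?_, ?_⟩ <;> rintro (_ | _) (_ | _) <;>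
        simp [leftClass, rightClass]
  | zero => exact ⟨0, by simp, by simp⟩
  | add x y _ _ hx hy =>
    obtain ⟨φ, h1, h2⟩ := hx
    obtain ⟨ψ, h3, h4⟩ := hy
    exact ⟨φ + ψ, by simp [h1, h3], by simp [h2, h4]⟩
  | smul c x _ hx =>
    obtain ⟨φ, h1, h2⟩ := hx
    exact ⟨c • φ, by simp [h1], by simp [h2]⟩

theorem isDendLike_dend :
    (Dend k).IsDendLike (m := 1) (Equiv.funUnique (Fin 1) DendOp).symm := by
  intro u hu
  obtain ⟨φ, h1, h2⟩ := exists_coeff_of_mem_dend_rel hu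
  exact ⟨fun c => φ (c 0), h1, h2⟩

theorem IsDendLike.blackSquare_dend {P : QuadraticData k} {m : ℕ} {e : P.Gen ≃ (Fin m → DendOp)}
    (h : P.IsDendLike e) : (P.blackSquare (Dend k)).IsDendLike (m := m + 1)
      (((Equiv.prodComm P.Gen DendOp).trans ((Equiv.refl DendOp).prodCongr e)).trans
        (Fin.consEquiv fun _ => DendOp)) := by
  intro (u : ((P.Gen × DendOp) × (P.Gen × DendOp) → k) ×
    ((P.Gen × DendOp) × (P.Gen × DendOp) → k)) hu
  replace hu : u ∈ Submodule.span k
    {w | ∃ u ∈ P.Rel, ∃ v ∈ (Dend k).Rel, w = (switch u.1 v.1, switch u.2 v.2)} := hu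
  induction hu using Submodule.span_induction with
  | mem x hx =>
    obtain ⟨u, hu, v, hv, rfl⟩ := hx
    obtain ⟨φ, h1, h2⟩ := h u hu
    obtain ⟨ψ, h3, h4⟩ := exists_coeff_of_mem_dend_rel hv
    -- `switch` multiplies coefficients coordinatewise; the new `Dend` factor is coordinate `0`.
    refine ⟨fun c => φ (fun i => c i.succ) * ψ (c 0), ?_, ?_⟩
    · rintro ⟨a, a'⟩ ⟨b, b'⟩
      exact congrArg₂ (· * ·) (h1 a b) (h3 a' b')
    · rintro ⟨a, a'⟩ ⟨b, b'⟩
      exact congrArg₂ (· * ·) (h2 a b) (h4 a' b')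
  | zero => exact ⟨0, fun _ _ => rfl, fun _ _ => rfl⟩
  | add x y _ _ hx hy =>
    obtain ⟨φ, h1, h2⟩ := hx
    obtain ⟨ψ, h3, h4⟩ := hy
    exact ⟨φ + ψ, fun a b => congrArg₂ (· + ·) (h1 a b) (h3 a b),
      fun a b => congrArg₂ (· + ·) (h2 a b) (h4 a b)⟩
  | smul c x _ hx =>
    obtain ⟨φ, h1, h2⟩ := hx
    exact ⟨c • φ, fun a b => congrArg (c * ·) (h1 a b), fun a b => congrArg (c * ·) (h2 a b)⟩

theorem exists_isDendLike_blackSquarePow (m : ℕ) :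
    ∃ e : ((Dend k).blackSquarePow (m + 1)).Gen ≃ (Fin (m + 1) → DendOp),
      ((Dend k).blackSquarePow (m + 1)).IsDendLike e := by
  induction m with
  | zero => exact ⟨_, isDendLike_dend⟩
  | succ m ih =>
    obtain ⟨e, he⟩ := ih
    exact ⟨_, he.blackSquare_dend⟩

-- Pairing with `u` leaves `u.1 (a, b) - u.2 (c, d)`, two values of one class function at the same
-- point.
open Classical in
theorem IsDendLike.single_mem_dual_rel {P : QuadraticData k} {m : ℕ}
    {e : P.Gen ≃ (Fin m → DendOp)} (h : P.IsDendLike e) {a b c d : P.Gen}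
    (hc : ∀ i, leftClass (e a i) (e b i) = rightClass (e c i) (e d i)) :
    (Pi.single (a, b) 1, Pi.single (c, d) 1) ∈ P.dual.Rel := by
  intro u hu
  obtain ⟨φ, h1, h2⟩ := h u hu
  have : u.1 (a, b) = u.2 (c, d) := by rw [h1, h2]; simp only [hc]
  simp [pairing, Pi.single_apply, this]

end QuadraticData

/-! ### Congruence of trees modulo an operadic ideal. -/

namespace FreeOperad

open DendOp

variable {k : Type*} [Field k] {X : Type}

/-- Two trees of the same arity are congruent modulo the family of subspaces `I`. -/
def TreeCongr (I : ℕ → Submodule k (BinaryTree X →₀ k)) (t s : BinaryTree X) : Prop :=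
  t.numLeaves = s.numLeaves ∧ Finsupp.single t 1 - Finsupp.single s 1 ∈ I t.numLeaves

namespace TreeCongr

variable {I : ℕ → Submodule k (BinaryTree X →₀ k)} {t s r : BinaryTree X}

theorem refl (t : BinaryTree X) : TreeCongr I t t := ⟨rfl, by simp⟩

theorem symm (h : TreeCongr I t s) : TreeCongr I s t :=
  ⟨h.1.symm, by rw [← h.1, ← neg_sub]; exact neg_mem h.2⟩

theorem trans (h : TreeCongr I t s) (h' : TreeCongr I s r) : TreeCongr I t r :=
  ⟨h.1.trans h'.1, by
    rw [← sub_add_sub_cancel]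
    exact add_mem h.2 (h.1 ▸ h'.2)⟩

end TreeCongr

theorem single_mem_component (t : BinaryTree X) :
    Finsupp.single t (1 : k) ∈ component k X t.numLeaves :=
  Finsupp.single_mem_supported k 1 rfl

theorem comp_single_sub (t a b : BinaryTree X) (i : ℕ) :
    comp (Finsupp.single t (1 : k)) i (Finsupp.single a 1 - Finsupp.single b 1) =
      Finsupp.single (graft t i a) 1 - Finsupp.single (graft t i b) 1 := by
  simp only [comp]
  rw [Finsupp.sum_single_index (by simp), Finsupp.sum_sub_index (by simp [Finsupp.single_sub])]
  simp

theorem comp_sub_single (t a b : BinaryTree X) (i : ℕ) :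
    comp (Finsupp.single a (1 : k) - Finsupp.single b 1) i (Finsupp.single t 1) =
      Finsupp.single (graft a i t) 1 - Finsupp.single (graft b i t) 1 := by
  have h (u : BinaryTree X →₀ k) :
      comp u i (Finsupp.single t 1) = u.sum fun s c => Finsupp.single (graft s i t) c := by
    simp only [comp]
    congr! with s c
    rw [Finsupp.sum_single_index (by simp), mul_one]
  rw [h, Finsupp.sum_sub_index (by simp [Finsupp.single_sub])]
  simp

theorem numLeaves_graft (t s : BinaryTree X) (i : ℕ) :
    (graft t i s).numLeaves = t.numLeaves + s.numLeaves - 1 := by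
  induction t generalizing i with
  | nil => simp [graft]
  | node x l r hl hr =>
    have h1 := l.numLeaves_pos
    have h2 := r.numLeaves_pos
    simp only [graft]
    split_ifs <;> simp only [BinaryTree.numLeaves, hl, hr] <;> omega

theorem comp_mem_component {p q : ℕ} {u v : BinaryTree X →₀ k} (hu : u ∈ component k X p) (i : ℕ)
    (hv : v ∈ component k X q) : comp u i v ∈ component k X (p + q - 1) := by
  refine sum_mem fun t ht => sum_mem fun s hs => Finsupp.single_mem_supported k _ ?_
  have h1 : t.numLeaves = p := hu ht
  have h2 : s.numLeaves = q := hv hs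
  rw [Set.mem_ofPred_eq, numLeaves_graft, h1, h2]

/-- This ideal contains all relators, which keeps the generated ideal inside the components. -/
theorem isIdeal_component : IsIdeal (component k X) where
  le_component _ := le_rfl
  comp_mem_left _ _ i _ _ hu _ hv := comp_mem_component hu i hv
  comp_mem_right _ _ i _ _ hu _ hv := comp_mem_component hu i hv

variable {I : ℕ → Submodule k (BinaryTree X →₀ k)}

theorem IsIdeal.congr_graft_right (hI : IsIdeal I) {t s : BinaryTree X} (h : TreeCongr I t s)
    (r : BinaryTree X) {i : ℕ} (hi : i < r.numLeaves) :
    TreeCongr I (graft r i t) (graft r i s) := by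
  refine ⟨by simp [numLeaves_graft, h.1], ?_⟩
  rw [← comp_single_sub, numLeaves_graft]
  exact hI.comp_mem_right _ _ _ hi _ (single_mem_component r) _ h.2

theorem IsIdeal.congr_graft_left (hI : IsIdeal I) {t s : BinaryTree X} (h : TreeCongr I t s)
    (r : BinaryTree X) {i : ℕ} (hi : i < t.numLeaves) :
    TreeCongr I (graft t i r) (graft s i r) := by
  refine ⟨by simp [numLeaves_graft, h.1], ?_⟩
  rw [← comp_sub_single, numLeaves_graft]
  exact hI.comp_mem_left _ _ _ hi _ h.2 _ (single_mem_component r)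

theorem IsIdeal.congr_node (hI : IsIdeal I) (x : X) {l l' r r' : BinaryTree X}
    (hl : TreeCongr I l l') (hr : TreeCongr I r r') :
    TreeCongr I (.node x l r) (.node x l' r') := by
  have h1 := hI.congr_graft_right hl (.node x .nil r) (i := 0) (by simp [BinaryTree.numLeaves])
  have h2 := hI.congr_graft_right hr (.node x l' .nil) (i := l'.numLeaves)
    (by simp [BinaryTree.numLeaves])
  simp only [graft, BinaryTree.numLeaves, zero_lt_one, if_true, lt_irrefl, if_false] at h1 h2
  exact h1.trans h2

/-- A congruence between the two trees of arity three propagates to all trees. -/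
theorem IsIdeal.congr_rotate (hI : IsIdeal I) {a b c d : X}
    (h : TreeCongr I (.node b (.node a .nil .nil) .nil) (.node c .nil (.node d .nil .nil)))
    (t s r : BinaryTree X) :
    TreeCongr I (.node b (.node a t s) r) (.node c t (.node d s r)) := by
  -- Grafting from right to left leaves the numbers of the remaining leaves unchanged.
  have h1 := hI.congr_graft_left h r (i := 2) (by simp [BinaryTree.numLeaves])
  simp [graft, BinaryTree.numLeaves] at h1
  have h2 := hI.congr_graft_left h1 s (i := 1) (by simp [BinaryTree.numLeaves]; omega)
  simp [graft, BinaryTree.numLeaves] at h2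
  have h3 := hI.congr_graft_left h2 t (i := 0) (by simp [BinaryTree.numLeaves])
  simpa [graft, BinaryTree.numLeaves] using h3

/-! ### Reduction of trees to normalized right combs. -/

variable {m : ℕ}

/-- The right comb with `n` inner vertices whose `i`-th coordinate is `≻` on the first `v i`
vertices and `≺` on the others. -/
def comb (e : X ≃ (Fin m → DendOp)) : ℕ → (Fin m → ℕ) → BinaryTree X
  | 0, _ => .nil
  | n + 1, v => .node (e.symm fun i => if v i = 0 then prec else succ) .nil
      -- Truncated subtraction keeps an exhausted coordinate at `0`, hence at `≺`.
      (comb e n fun i => v i - 1)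

theorem numLeaves_comb (e : X ≃ (Fin m → DendOp)) (n : ℕ) (v : Fin m → ℕ) :
    (comb e n v).numLeaves = n + 1 := by
  induction n generalizing v with
  | zero => rfl
  | succ n ih => simp [comb, BinaryTree.numLeaves, ih]; omega

theorem comb_min (e : X ≃ (Fin m → DendOp)) (n : ℕ) (v : Fin m → ℕ) :
    comb e n (fun i => min (v i) n) = comb e n v := by
  induction n generalizing v with
  | zero => rfl
  | succ n ih =>
    simp only [comb]
    congr 1
    · congr 1
      funext i
      simp
    · rw [← ih fun i => v i - 1]
      congr 1
      funext i
      omega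

/-- An operadic ideal modulo which trees of arity three with the same coordinatewise classes are
congruent. -/
structure IsDendIdeal (e : X ≃ (Fin m → DendOp))
    (I : ℕ → Submodule k (BinaryTree X →₀ k)) : Prop where
  isIdeal : IsIdeal I
  congr_of_class : ∀ a b c d : X,
    (∀ i, leftClass (e a i) (e b i) = rightClass (e c i) (e d i)) →
    TreeCongr I (.node b (.node a .nil .nil) .nil) (.node c .nil (.node d .nil .nil))

namespace IsDendIdeal

variable {e : X ≃ (Fin m → DendOp)}

/-- Both trees are rotations of one left-nested tree of the common class. -/
theorem congr_right (hI : IsDendIdeal e I) {a b c d : X}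
    (h : ∀ i, rightClass (e a i) (e b i) = rightClass (e c i) (e d i)) (t s r : BinaryTree X) :
    TreeCongr I (.node a t (.node b s r)) (.node c t (.node d s r)) := by
  choose p hp using fun i => exists_leftClass_eq (rightClass (e a i) (e b i))
  have hab := hI.congr_of_class (e.symm fun i => (p i).1) (e.symm fun i => (p i).2) a b
    (by simp [hp])
  have hcd := hI.congr_of_class (e.symm fun i => (p i).1) (e.symm fun i => (p i).2) c d
    (by simp [hp, h])
  exact (hI.isIdeal.congr_rotate hab t s r).symm.trans (hI.isIdeal.congr_rotate hcd t s r)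

/-- A coordinate in which the root is `≺` may be reset to `≺` all along the comb, one vertex at a
time. -/
theorem congr_node_nil_comb (hI : IsDendIdeal e I) (n : ℕ) (x : X) (v w : Fin m → ℕ)
    (hs : ∀ i, e x i = succ → v i = w i) (hp : ∀ i, e x i = prec → w i = 0) :
    TreeCongr I (.node x .nil (comb e n v)) (.node x .nil (comb e n w)) := by
  induction n generalizing x v w with
  | zero => exact .refl _
  | succ n ih =>
    refine (hI.congr_right (c := x) (d := e.symm fun i => if w i = 0 then prec else succ)
      ?_ _ _ _).trans (hI.isIdeal.congr_node x (.refl _) (ih _ _ _ ?_ ?_))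
    · intro i
      cases hx : e x i
      · rfl
      · simp [hs i hx]
    · intro i hi
      have hw : w i ≠ 0 := by
        intro h0
        simp [h0] at hi
      cases hx : e x i
      · exact absurd (hp i hx) hw
      · simp [hs i hx]
    · intro i hi
      by_cases h0 : w i = 0
      · simp [h0]
      · simp [h0] at hi

theorem exists_congr_comb_node_nil (hI : IsDendIdeal e I) (n : ℕ) (x : X) (v : Fin m → ℕ) :
    ∃ w, TreeCongr I (.node x .nil (comb e n v)) (comb e (n + 1) w) := by
  -- A root `≺` absorbs the run below it; a root `≻` lengthens it by one.
  refine ⟨fun i => if e x i = prec then 0 else v i + 1, ?_⟩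
  have hx : (e.symm fun i => if (if e x i = prec then 0 else v i + 1) = 0 then prec else succ)
      = x := by
    rw [Equiv.symm_apply_eq]
    funext i
    cases h : e x i <;> simp
  simp only [comb, hx]
  apply hI.congr_node_nil_comb
  · intro i hi
    simp [hi]
  · intro i hi
    simp [hi]

/-- Rotating at the root shortens the left comb by one vertex; the root label changes, so the
induction on `p` is uniform in `x`. -/
theorem exists_congr_comb_node (hI : IsDendIdeal e I) (p q : ℕ) (x : X) (v w : Fin m → ℕ) :
    ∃ z, TreeCongr I (.node x (comb e p v) (comb e q w)) (comb e (p + q + 1) z) := by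
  induction p generalizing x v with
  | zero =>
    rw [zero_add]
    exact hI.exists_congr_comb_node_nil q x w
  | succ p ih =>
    rw [comb]
    set y := e.symm fun i => if v i = 0 then prec else succ
    choose c hc using fun i => exists_rightClass_eq (leftClass (e y i) (e x i))
    obtain ⟨z, hz⟩ := ih (e.symm fun i => (c i).2) fun i => v i - 1
    obtain ⟨z', hz'⟩ := hI.exists_congr_comb_node_nil (p + q + 1) (e.symm fun i => (c i).1) z
    have hyx := hI.congr_of_class y x (e.symm fun i => (c i).1) (e.symm fun i => (c i).2)
      (by simp [hc])
    refine ⟨z', ?_⟩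
    rw [show p + 1 + q + 1 = p + q + 1 + 1 by omega]
    exact (hI.isIdeal.congr_rotate hyx _ _ _).trans
      ((hI.isIdeal.congr_node _ (.refl _) hz).trans hz')

theorem exists_congr_comb (hI : IsDendIdeal e I) (t : BinaryTree X) :
    ∃ n v, TreeCongr I t (comb e n v) := by
  induction t with
  | nil => exact ⟨0, 0, .refl _⟩
  | node x l r hl hr =>
    obtain ⟨p, v, hv⟩ := hl
    obtain ⟨q, w, hw⟩ := hr
    obtain ⟨z, hz⟩ := hI.exists_congr_comb_node p q x v w
    exact ⟨_, z, (hI.isIdeal.congr_node x hv hw).trans hz⟩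

end IsDendIdeal

-- The ideal of the dual and the dimension bound.

end FreeOperad

namespace QuadraticData

open DendOp FreeOperad

variable {k : Type*} [Field k]

theorem relator_mem_component {X : Type} [Fintype X] (w : (X × X → k) × (X × X → k)) :
    relator w ∈ FreeOperad.component k X 3 :=
  sub_mem (sum_mem fun _ _ => Finsupp.single_mem_supported k _ rfl)
    (sum_mem fun _ _ => Finsupp.single_mem_supported k _ rfl)

theorem isIdeal_ideal (P : QuadraticData k) : IsIdeal P.ideal where
  le_component n := sInf_le
    ⟨_, isIdeal_component, fun w _ => relator_mem_component w, rfl⟩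
  comp_mem_left p q i hi u hu v hv := by
    simp only [ideal, Submodule.mem_sInf] at hu ⊢
    rintro _ ⟨I, hI, hw, rfl⟩
    exact hI.comp_mem_left p q i hi u (hu _ ⟨I, hI, hw, rfl⟩) v hv
  comp_mem_right p q i hi u hu v hv := by
    simp only [ideal, Submodule.mem_sInf] at hv ⊢
    rintro _ ⟨I, hI, hw, rfl⟩
    exact hI.comp_mem_right p q i hi u hu v (hv _ ⟨I, hI, hw, rfl⟩)

theorem relator_mem_ideal (P : QuadraticData k) {w : (P.Gen × P.Gen → k) × (P.Gen × P.Gen → k)}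
    (hw : w ∈ P.Rel) : relator w ∈ P.ideal 3 := by
  simp only [ideal, Submodule.mem_sInf]
  rintro _ ⟨I, _, h, rfl⟩
  exact h w hw

open Classical in
theorem relator_single {X : Type} [Fintype X] (a b c d : X) :
    relator (Pi.single (a, b) (1 : k), Pi.single (c, d) (1 : k)) =
      Finsupp.single (.node b (.node a .nil .nil) .nil) 1 -
        Finsupp.single (.node c .nil (.node d .nil .nil)) 1 := by
  rw [relator, Finset.sum_eq_single (a, b), Finset.sum_eq_single (c, d)]
  · simp
  all_goals simp +contextual

theorem IsDendLike.isDendIdeal_dual {P : QuadraticData k} {m : ℕ}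
    {e : P.Gen ≃ (Fin m → DendOp)} (h : P.IsDendLike e) :
    IsDendIdeal (X := P.dual.Gen) e P.dual.ideal where
  isIdeal := P.dual.isIdeal_ideal
  congr_of_class a b c d hc :=
    ⟨rfl, (congrArg (· ∈ P.dual.ideal 3)
      (relator_single (k := k) (X := P.dual.Gen) a b c d)).mp
      (P.dual.relator_mem_ideal (h.single_mem_dual_rel hc))⟩

theorem rank_component_le_of_isDendIdeal (P : QuadraticData k) {m : ℕ}
    {e : P.Gen ≃ (Fin m → DendOp)} (h : IsDendIdeal e P.ideal) (n : ℕ) :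
    Module.rank k (P.component (n + 1)) ≤ (((n + 1) ^ m : ℕ) : Cardinal) := by
  let b (v : Fin m → Fin (n + 1)) : (BinaryTree P.Gen →₀ k) ⧸ P.ideal (n + 1) :=
    (P.ideal (n + 1)).mkQ (Finsupp.single (comb e n fun i => v i) 1)
  have hle : P.component (n + 1) ≤ Submodule.span k (Set.range b) := by
    rw [component, FreeOperad.component, Finsupp.supported_eq_span_single, Submodule.map_span,
      Submodule.span_le]
    rintro _ ⟨_, ⟨t, ht, rfl⟩, rfl⟩
    obtain ⟨n', v, hv, hmem⟩ := h.exists_congr_comb t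
    rw [Set.mem_ofPred_eq] at ht
    obtain rfl : n' = n := by
      rw [numLeaves_comb] at hv
      omega
    rw [ht] at hmem
    -- Runs longer than the comb give the same labels, so lengths can be capped.
    refine Submodule.subset_span ⟨fun i => ⟨min (v i) n', by omega⟩, ?_⟩
    simp only [b, comb_min]
    exact ((Submodule.Quotient.eq _).2 hmem).symm
  calc Module.rank k (P.component (n + 1))
      ≤ Module.rank k (Submodule.span k (Set.range b)) := Submodule.rank_mono hle
    _ ≤ Cardinal.mk (Set.range b) := rank_span_le _
    _ ≤ (((n + 1) ^ m : ℕ) : Cardinal) := by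
      have hb := Cardinal.mk_range_le_lift (f := b)
      rw [Cardinal.mk_fintype (Fin m → Fin (n + 1))] at hb
      simpa only [Cardinal.lift_uzero, Cardinal.lift_natCast, Fintype.card_pi, Fintype.card_fin,
        Finset.prod_const, Finset.card_univ] using hb

theorem rank_component_zero (P : QuadraticData k) : Module.rank k (P.component 0) = 0 := by
  have : FreeOperad.component k P.Gen 0 = ⊥ := by
    rw [FreeOperad.component, show {t : BinaryTree P.Gen | t.numLeaves = 0} = ∅ from
      Set.eq_empty_of_forall_notMem fun t => t.numLeaves_pos.ne']
    exact Finsupp.supported_empty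
  rw [component, this, Submodule.map_bot, rank_bot]

end QuadraticData

theorem lemma5p3 (k : Type*) [Field k] [IsAlgClosed k] [CharZero k] (m : ℕ) (hm : 1 ≤ m) (n : ℕ) :
    Module.rank k ((QuadraticData.blackSquarePow (Dend k) m).dual.component n) ≤
      ((n ^ m : ℕ) : Cardinal) := by
  obtain ⟨m, rfl⟩ := Nat.exists_eq_add_of_le' hm
  cases n with
  | zero => simp [QuadraticData.rank_component_zero]
  | succ n =>
    obtain ⟨e, he⟩ := QuadraticData.exists_isDendLike_blackSquarePow (k := k) m
    exact QuadraticData.rank_component_le_of_isDendIdeal _ he.isDendIdeal_dual n
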